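/- Let $d,T\ge 1$ be integers and let $\sigma:\mathbb R\to\mathbb R$ be continuous, bounded, injective, not a polynomial, and such that $\sigma(0)=0$; for a vector $z$ let $\sigma(z)$ denote the vector obtained by applying $\sigma$ to each coordinate. Given $N\in\mathbb N$, matrices $A_1,A_2^1,\dots,A_2^d\in\mathbb R^{N\times N}$ and vectors $\xi_1,\xi_2^1,\dots,\xi_2^d\in\mathbb R^N$, the randomised signature of $x=(x_1,\dots,x_T)\in(\mathbb R^d)^T$ is defined by $\mathrm{RS}_0(x)=0\in\mathbb R^N$ and $$\mathrm{RS}_t(x)=\mathrm{RS}_{t-1}(x)+\sigma\big(A_1\mathrm{RS}_{t-1}(x)+\xi_1\big)+\sum_{i=1}^d\sigma\big(A_2^i\,\mathrm{RS}_{t-1}(x)+\xi_2^i\big)\,x_t^i,\qquad t=1,\dots,T,$$ and $\Delta\mathrm{RS}_T(x)=\mathrm{RS}_T(x)-\mathrm{RS}_{T-1}(x)$. Sampling Scheme 1. Let $\mu_1$ be a probability distribution on $\mathbb R$ that is absolutely continuous with respect to Lebesgue measure and has full support. For $M\in\mathbb N$ put $N=M+Td$ and $$A_1=\begin{bmatrix}0_{M\times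 M}&A\\0_{Td\times M}&\begin{bmatrix}0_{d\times(T-1)d}&0_{d\times d}\\U&0_{(T-1)d\times d}\end{bmatrix}\end{bmatrix},\quad \xi_1=\begin{bmatrix}\xi\\0_{Td\times1}\end{bmatrix},\quad A_2^i=0_{N\times N},\quad \xi_2^i=\begin{bmatrix}0_{M\times1}\\a_ie_i\end{bmatrix},$$ where $e_i$ is the $i$-th canonical basis vector of $\mathbb R^{Td}$, $A$ is a random $M\times Td$ matrix, $\xi$ is a random vector in $\mathbb R^M$, $U$ is an upper triangular random $(T-1)d\times(T-1)d$ matrix, $a_1,\dots,a_d$ are random variables, and all the entries of $A$, of $U$ on and above the diagonal, of $\xi$, and $a_1,\dots,a_d$ are i.i.d. with distribution $\mu_1$. Let $K\subseteq\mathbb R^d$ be compact and let $f:K^{T-1}\to\mathbb R$ be continuous. Then for every $\alpha\in(0,1)$ and every $\varepsilon>0$ there is an integer $M\ge1$ such that, whenever the weights are sampled according to Sampling Scheme 1 with this $M$, with probability greater than $\alpha$ there exists $\tilde w\in\mathbb R^M$ such that $w=(\tilde w,0)\in\mathbb R^{M+Td}$ satisfies $$\sup\big|f(x_1,\dots,x_{T-1})-\langle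 w,\Delta\mathrm{RS}_T(x)\rangle\big|<\varepsilon ,$$ where the supremum is taken over all $x=(x_1,\dots,x_T)$ with $x_1,\dots,x_{T-1}\in K$ and $x_T\in\mathbb R^d$ arbitrary. -/

import Mathlib

open MeasureTheory ProbabilityTheory Matrix

noncomputable section

namespace RandSig

/-- The randomised signature with coefficients `A₁, ξ₁, A₂, ξ₂` and activation `σ` (applied
coordinatewise) of the datastream `x`: `RS_0 = 0` and
`RS_{t+1} = RS_t + σ(A₁ RS_t + ξ₁) + ∑ i, σ(A₂ⁱ RS_t + ξ₂ⁱ) x_{t+1}ⁱ`.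
The stream `x_1, …, x_T` is stored as `x 0, …, x (T - 1)`; the times of `RS` are `0, …, T`.
The state space is `ℝ^ι`, where `ι` is any finite index set. -/
def RS {ι : Type*} [Fintype ι] {d T : ℕ} (σ : ℝ → ℝ)
    (A₁ : Matrix ι ι ℝ) (ξ₁ : ι → ℝ) (A₂ : Fin d → Matrix ι ι ℝ) (ξ₂ : Fin d → ι → ℝ)
    (x : Fin T → EuclideanSpace ℝ (Fin d)) (t : Fin (T + 1)) : ι → ℝ :=
  Fin.induction (motive := fun _ => ι → ℝ) 0
    (fun s r => r + (fun k => σ ((A₁ *ᵥ r + ξ₁) k))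
      + ∑ i : Fin d, x s i • (fun k => σ ((A₂ i *ᵥ r + ξ₂ i) k))) t

/-- The increment `RS_{t+1} - RS_t`. With `t = T - 1` this is the terminal increment `ΔRS_T`. -/
def deltaRS {ι : Type*} [Fintype ι] {d T : ℕ} (σ : ℝ → ℝ)
    (A₁ : Matrix ι ι ℝ) (ξ₁ : ι → ℝ) (A₂ : Fin d → Matrix ι ι ℝ) (ξ₂ : Fin d → ι → ℝ)
    (x : Fin T → EuclideanSpace ℝ (Fin d)) (t : Fin T) : ι → ℝ :=
  RS σ A₁ ξ₁ A₂ ξ₂ x t.succ - RS σ A₁ ξ₁ A₂ ξ₂ x t.castSucc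

/-- The index set of `ℝ^{Td} = (ℝ^d)^T`: the pair `(k, i)` stands for coordinate number `k d + i`
(counted from `0`), so the usual order of the coordinates is the lexicographic order of pairs. -/
abbrev Block (T d : ℕ) : Type := Fin T × Fin d

/-- The index set of `ℝ^N` with `N = M + T d`. -/
abbrev State (M T d : ℕ) : Type := Fin M ⊕ Block T d

/-- The matrix `[0 0; U 0]` of size `Td × Td`, with the `(T-1)d × (T-1)d` matrix `U` in the lower
left corner, a zero block row of height `d` on top and a zero block column of width `d` on the
right. -/
def shiftMatrix {T d : ℕ} (U : Matrix (Block (T - 1) d) (Block (T - 1) d) ℝ) :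
    Matrix (Block T d) (Block T d) ℝ :=
  Matrix.of fun p q =>
    if h : 1 ≤ p.1.val ∧ q.1.val < T - 1 then
      U (⟨p.1.val - 1, by have := p.1.isLt; omega⟩, p.2) (⟨q.1.val, h.2⟩, q.2)
    else 0

/-- The matrix `A₁ = [0 A; 0 [0 0; U 0]]`. -/
def schemeA₁ {M T d : ℕ} (A : Matrix (Fin M) (Block T d) ℝ)
    (U : Matrix (Block (T - 1) d) (Block (T - 1) d) ℝ) :
    Matrix (State M T d) (State M T d) ℝ :=
  Matrix.fromBlocks 0 A 0 (shiftMatrix U)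

/-- The bias `ξ₁ = [ξ; 0]`. -/
def schemeξ₁ {M : ℕ} (T d : ℕ) (ξ : Fin M → ℝ) : State M T d → ℝ :=
  Sum.elim ξ 0

/-- The matrices `A₂ⁱ = 0`. -/
def schemeA₂ (M T d : ℕ) : Fin d → Matrix (State M T d) (State M T d) ℝ :=
  fun _ => 0

/-- The biases `ξ₂ⁱ = [0; aᵢ eᵢ]`, where `eᵢ` is the `i`-th canonical basis vector of `ℝ^{Td}`
(`i = 1, …, d`), that is, the coordinate `i` of the first block. -/
def schemeξ₂ (M T : ℕ) {d : ℕ} (a : Fin d → ℝ) : Fin d → State M T d → ℝ :=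
  fun i => Sum.elim 0 (fun p => if p.1.val = 0 ∧ p.2 = i then a i else 0)

/-- The labels of the random entries: the entries of `A`, the entries of `U` on and above the
diagonal, the entries of `ξ`, and `a₁, …, a_d`. -/
abbrev EntryIndex (M T d : ℕ) : Type :=
  (Fin M × Block T d) ⊕
    {pq : Block (T - 1) d × Block (T - 1) d // toLex pq.1 ≤ toLex pq.2} ⊕ Fin M ⊕ Fin d

/-- The family of all random entries. -/
def entries {Ω : Type*} {M T d : ℕ} (A : Ω → Matrix (Fin M) (Block T d) ℝ)
    (U : Ω → Matrix (Block (T - 1) d) (Block (T - 1) d) ℝ) (ξ : Ω → Fin M → ℝ)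
    (a : Ω → Fin d → ℝ) : EntryIndex M T d → Ω → ℝ :=
  Sum.elim (fun jp ω => A ω jp.1 jp.2)
    (Sum.elim (fun pq ω => U ω pq.1.1 pq.1.2)
      (Sum.elim (fun j ω => ξ ω j) (fun i ω => a ω i)))

/-- The first sampling scheme: `U` is upper triangular, and all the entries of `A`, the entries of
`U` on and above the diagonal, the entries of `ξ` and the variables `a₁, …, a_d` are independent
random variables with the common distribution `μ₁`. -/
structure IsSamplingScheme {Ω : Type*} [MeasurableSpace Ω] (P : Measure Ω) (μ₁ : Measure ℝ)
    {M T d : ℕ} (A : Ω → Matrix (Fin M) (Block T d) ℝ)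
    (U : Ω → Matrix (Block (T - 1) d) (Block (T - 1) d) ℝ) (ξ : Ω → Fin M → ℝ)
    (a : Ω → Fin d → ℝ) : Prop where
  upper : ∀ ω p q, toLex q < toLex p → U ω p q = 0
  measurable : ∀ k, Measurable (entries A U ξ a k)
  law : ∀ k, P.map (entries A U ξ a k) = μ₁
  indep : iIndepFun (entries A U ξ a) P

/-- The standing assumption on the activation function. -/
structure IsActivation (σ : ℝ → ℝ) : Prop where
  continuous : Continuous σ
  bounded : ∃ C : ℝ, ∀ z, |σ z| ≤ C
  not_polynomial : ¬ ∃ p : Polynomial ℝ, ∀ z, σ z = p.eval z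
  injective : Function.Injective σ
  map_zero : σ 0 = 0

end RandSig

end

/-! The first `M` coordinates of `ΔRS_T` are random neurons applied to the last `T d` coordinates of
`RS_{T-1}`. If the diagonal of `U` and the `aᵢ` do not vanish, this part of the state is an
injective function of `x_1, …, x_{T-1}`: before each of these steps the last block is still zero, so
the state before the step can be recovered from the state after it, coordinate by coordinate from
the last block to the first by back substitution in `U`, and then the first block reveals the input.
By the universal approximation theorem, finitely many neurons with suitable weights approximate
`f`, and they still do so when their weights, `U` and the `aᵢ` are slightly perturbed. On a compact
set of parameters `(U, a)` of probability close to one, finitely many nonempty open sets of weights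
therefore suffice, and `M` independent rows of `[A ξ]` visit all of these sets with probability
tending to one as `M → ∞`. -/

namespace RandSig

open Filter Topology

section Sigmoid

variable {τ : ℝ → ℝ} {C : ℝ}

/-- Only the summand `k = ⌊u⌋₊` can be far off, because the steps are centred at half-integers. -/
theorem exists_scale_abs_step_sub_le (htop : Tendsto τ atTop (𝓝 1)) (hbot : Tendsto τ atBot (𝓝 0))
    {η : ℝ} (hη : 0 < η) :
    ∃ s : ℝ, ∀ (u : ℝ) (k : ℕ), k ≠ ⌊u⌋₊ →
      |(if k < ⌊u⌋₊ then (1 : ℝ) else 0) - τ (s * (u - (k + 1 / 2)))| ≤ η := by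
  obtain ⟨z₁, hz₁⟩ := eventually_atTop.1 (Metric.tendsto_nhds.1 htop η hη)
  obtain ⟨z₀, hz₀⟩ := eventually_atBot.1 (Metric.tendsto_nhds.1 hbot η hη)
  refine ⟨2 * max |z₁| |z₀|, fun u k hk => ?_⟩
  have hs₁ : z₁ ≤ max |z₁| |z₀| := (le_abs_self _).trans (le_max_left _ _)
  have hs₀ : -max |z₁| |z₀| ≤ z₀ := neg_le.2 ((neg_le_abs _).trans (le_max_right _ _))
  have hs : 0 ≤ max |z₁| |z₀| := (abs_nonneg _).trans (le_max_left _ _)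
  rcases hk.lt_or_gt with hlt | hgt
  · have hu : (k : ℝ) + 1 ≤ u := by
      exact_mod_cast (Nat.le_floor_iff' k.succ_ne_zero).1 hlt
    have hτ := hz₁ (2 * max |z₁| |z₀| * (u - (k + 1 / 2))) (by nlinarith)
    rw [if_pos hlt, abs_sub_comm]
    exact hτ.le
  · have hu : u < k := (Nat.floor_lt' (Nat.ne_zero_of_lt hgt)).1 hgt
    have hτ := hz₀ (2 * max |z₁| |z₀| * (u - (k + 1 / 2))) (by nlinarith)
    rw [Real.dist_eq, sub_zero] at hτ
    rw [if_neg hgt.le.not_gt, zero_sub, abs_neg]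
    exact hτ.le

theorem exists_scale_sum_abs_step_sub_le (hC : ∀ z, |τ z| ≤ C) (htop : Tendsto τ atTop (𝓝 1))
    (hbot : Tendsto τ atBot (𝓝 0)) (n : ℕ) :
    ∃ s : ℝ, ∀ u : ℝ, ∑ k ∈ Finset.range n,
      |(if k < ⌊u⌋₊ then (1 : ℝ) else 0) - τ (s * (u - (k + 1 / 2)))| ≤ C + 1 := by
  have hC₀ : 0 ≤ C := (abs_nonneg _).trans (hC 0)
  obtain ⟨s, hs⟩ := exists_scale_abs_step_sub_le htop hbot (Nat.one_div_pos_of_nat (n := n))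
  refine ⟨s, fun u => ?_⟩
  have hterm : ∀ k ∈ Finset.range n,
      |(if k < ⌊u⌋₊ then (1 : ℝ) else 0) - τ (s * (u - (k + 1 / 2)))| ≤
        (if k = ⌊u⌋₊ then C else 0) + 1 / (n + 1) := by
    intro k _
    split_ifs with hlt heq heq
    · exact absurd hlt heq.not_lt
    · simpa [hlt] using hs u k heq
    · simpa using (hC _).trans (le_add_of_nonneg_right (Nat.one_div_pos_of_nat (n := n)).le)
    · simpa [hlt] using hs u k heq
  calc _ ≤ ∑ k ∈ Finset.range n, ((if k = ⌊u⌋₊ then C else 0) + 1 / ((n : ℝ) + 1)) :=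
        Finset.sum_le_sum hterm
    _ ≤ C + 1 := by
        rw [Finset.sum_add_distrib, Finset.sum_ite_eq', Finset.sum_const, Finset.card_range,
          nsmul_eq_mul, mul_one_div]
        gcongr
        · split_ifs <;> simp [hC₀]
        · exact div_le_one_of_le₀ (by linarith) (by positivity)

theorem sum_range_sub_mul_ite {n j : ℕ} (h : ℕ → ℝ) (hj : j ≤ n) :
    ∑ k ∈ Finset.range n, (h (k + 1) - h k) * (if k < j then 1 else 0) = h j - h 0 := by
  rw [← Finset.sum_range_sub h, ← Finset.sum_subset (Finset.range_subset_range.2 hj)]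
  · exact Finset.sum_congr rfl fun k hk => by rw [if_pos (Finset.mem_range.1 hk), mul_one]
  · intro k _ hk
    rw [if_neg (mt Finset.mem_range.2 hk), mul_zero]

theorem exists_scale_abs_sub_sigmoid_sum_le (hC : ∀ z, |τ z| ≤ C)
    (htop : Tendsto τ atTop (𝓝 1)) (hbot : Tendsto τ atBot (𝓝 0)) (n : ℕ) :
    ∃ s : ℝ, ∀ (h : ℕ → ℝ) (δ : ℝ), 0 ≤ δ → (∀ k < n, |h (k + 1) - h k| ≤ δ) →
      ∀ u : ℝ, ⌊u⌋₊ ≤ n →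
      |h ⌊u⌋₊ - (h 0 + ∑ k ∈ Finset.range n, (h (k + 1) - h k) * τ (s * (u - (k + 1 / 2))))| ≤
        δ * (C + 1) := by
  obtain ⟨s, hs⟩ := exists_scale_sum_abs_step_sub_le hC htop hbot n
  refine ⟨s, fun h δ hδ₀ hδ u hu => ?_⟩
  calc _ = |∑ k ∈ Finset.range n, (h (k + 1) - h k) *
          ((if k < ⌊u⌋₊ then 1 else 0) - τ (s * (u - (k + 1 / 2))))| := by
        simp only [mul_sub, Finset.sum_sub_distrib, sum_range_sub_mul_ite h hu, sub_sub]
    _ ≤ ∑ k ∈ Finset.range n,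
          δ * |(if k < ⌊u⌋₊ then 1 else 0) - τ (s * (u - (k + 1 / 2)))| := by
        refine (Finset.abs_sum_le_sum_abs _ _).trans (Finset.sum_le_sum fun k hk => ?_)
        rw [abs_mul]
        gcongr
        exact hδ k (Finset.mem_range.1 hk)
    _ ≤ δ * (C + 1) := by
        rw [← Finset.mul_sum]
        gcongr
        exact hs u

theorem exists_grid_of_continuousOn_Icc {g : ℝ → ℝ} (hg : ContinuousOn g (Set.Icc 0 1)) {δ : ℝ}
    (hδ : 0 < δ) :
    ∃ n : ℕ, (∀ k < n, |g ((k + 1 : ℕ) / n) - g (k / n)| ≤ δ) ∧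
      ∀ t ∈ Set.Icc (0 : ℝ) 1, |g t - g (⌊n * t⌋₊ / n)| ≤ δ := by
  obtain ⟨r, hr, hgr⟩ := Metric.uniformContinuousOn_iff.1
    (isCompact_Icc.uniformContinuousOn_of_continuous hg) δ hδ
  obtain ⟨n, hn⟩ := exists_nat_one_div_lt hr
  have hn₀ : (0 : ℝ) < (n + 1 : ℕ) := by positivity
  have hnode : ∀ k ≤ n + 1, (k : ℝ) / (n + 1 : ℕ) ∈ Set.Icc (0 : ℝ) 1 := fun k hk =>
    ⟨by positivity, (div_le_one hn₀).2 (by exact_mod_cast hk)⟩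
  refine ⟨n + 1, fun k hk => (hgr _ (hnode _ hk) _ (hnode _ hk.le) ?_).le, fun t ht => ?_⟩
  · rw [Real.dist_eq, ← sub_div, Nat.cast_succ k, add_sub_cancel_left, abs_of_pos (by positivity)]
    exact_mod_cast hn
  · have hnt : 0 ≤ (n + 1 : ℕ) * t := mul_nonneg hn₀.le ht.1
    refine (hgr _ ht _ (hnode _ ?_) ?_).le
    · exact Nat.floor_le_of_le (mul_le_of_le_one_right hn₀.le ht.2)
    · have hfloor := Nat.lt_floor_add_one ((n + 1 : ℕ) * t)
      rw [Real.dist_eq, show t - ⌊(n + 1 : ℕ) * t⌋₊ / (n + 1 : ℕ) =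
          ((n + 1 : ℕ) * t - ⌊(n + 1 : ℕ) * t⌋₊) / (n + 1 : ℕ) by field_simp,
        abs_of_nonneg (div_nonneg (sub_nonneg.2 (Nat.floor_le hnt)) hn₀.le)]
      refine lt_of_le_of_lt ?_ hn
      push_cast at hfloor ⊢
      gcongr
      linarith

theorem exists_sigmoid_sum_approx (hC : ∀ z, |τ z| ≤ C) (htop : Tendsto τ atTop (𝓝 1))
    (hbot : Tendsto τ atBot (𝓝 0)) {g : ℝ → ℝ} (hg : ContinuousOn g (Set.Icc 0 1)) {ε : ℝ}
    (hε : 0 < ε) :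
    ∃ (n : ℕ) (c b : ℕ → ℝ) (s : ℝ), ∀ t ∈ Set.Icc (0 : ℝ) 1,
      |g t - (g 0 + ∑ k ∈ Finset.range n, c k * τ (s * t + b k))| < ε := by
  have hC₀ : 0 ≤ C := (abs_nonneg _).trans (hC 0)
  have hδ : 0 < ε / (C + 3) := by positivity
  obtain ⟨n, hstep, hgrid⟩ := exists_grid_of_continuousOn_Icc hg hδ
  obtain ⟨s, hs⟩ := exists_scale_abs_sub_sigmoid_sum_le hC htop hbot n
  refine ⟨n, fun k => g ((k + 1 : ℕ) / n) - g (k / n), fun k => -(s * (k + 1 / 2)), s * n,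
    fun t ht => ?_⟩
  have hfloor : ⌊(n : ℝ) * t⌋₊ ≤ n :=
    Nat.floor_le_of_le (mul_le_of_le_one_right n.cast_nonneg ht.2)
  have hstair := hs (fun k => g (k / n)) _ hδ.le hstep (n * t) hfloor
  simp only [mul_sub s, ← mul_assoc, Nat.cast_zero, zero_div, sub_eq_add_neg (s * n * t)] at hstair
  calc _ ≤ ε / (C + 3) + ε / (C + 3) * (C + 1) := by
        exact (abs_sub_le _ (g (⌊n * t⌋₊ / n)) _).trans (add_le_add (hgrid t ht) hstair)
    _ < ε / (C + 3) * (C + 3) := by linarith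
    _ = ε := by field_simp

theorem exists_forall_abs_le_of_tendsto {σ : ℝ → ℝ} (hσ : Continuous σ) {l L : ℝ}
    (hbot : Tendsto σ atBot (𝓝 l)) (htop : Tendsto σ atTop (𝓝 L)) : ∃ C, ∀ z, |σ z| ≤ C := by
  obtain ⟨z₀, hz₀⟩ := eventually_atBot.1 (hbot.abs.eventually_le_const (lt_add_one |l|))
  obtain ⟨z₁, hz₁⟩ := eventually_atTop.1 (htop.abs.eventually_le_const (lt_add_one |L|))
  obtain ⟨B, hB⟩ := (isCompact_Icc (a := z₀) (b := z₁)).exists_bound_of_continuousOn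
    hσ.continuousOn
  refine ⟨max B (max (|l| + 1) (|L| + 1)), fun z => ?_⟩
  rcases le_total z z₀ with h₀ | h₀
  · exact (hz₀ z h₀).trans (by simp)
  rcases le_total z₁ z with h₁ | h₁
  · exact (hz₁ z h₁).trans (by simp)
  · exact (hB z ⟨h₀, h₁⟩).trans (le_max_left _ _)

end Sigmoid

section UniversalApproximation

theorem mem_closure_iff_forall_isCompact_abs_sub_lt {X : Type*} [TopologicalSpace X]
    {S : Set C(X, ℝ)} {F : C(X, ℝ)} :
    F ∈ closure S ↔ ∀ K, IsCompact K → ∀ ε > 0, ∃ G ∈ S, ∀ x ∈ K, |F x - G x| < ε := by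
  rw [mem_closure_iff_nhds_basis
    (nhds_basis_uniformity' Metric.uniformity_basis_dist.compactConvergenceUniformity)]
  simp only [Prod.forall, and_imp, UniformSpace.ball, Set.mem_preimage, Set.mem_ofPred_eq,
    Real.dist_eq, gt_iff_lt]
  exact forall_congr' fun K => forall_comm

variable {E : Type*} [AddCommGroup E] [Module ℝ E] [TopologicalSpace E]

/-- The ridge function `x ↦ σ (ℓ x + b)`: a single neuron of activation `σ` on the space `E`. -/
def ridge (σ : C(ℝ, ℝ)) (ℓ : StrongDual ℝ E) (b : ℝ) : C(E, ℝ) where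
  toFun x := σ (ℓ x + b)

/-- The linear span of all ridge functions of activation `σ`. -/
def ridgeSpan (E : Type*) [AddCommGroup E] [Module ℝ E] [TopologicalSpace E] (σ : C(ℝ, ℝ)) :
    Submodule ℝ C(E, ℝ) :=
  Submodule.span ℝ (Set.range fun p : StrongDual ℝ E × ℝ => ridge σ p.1 p.2)

theorem ridge_mem_ridgeSpan (σ : C(ℝ, ℝ)) (ℓ : StrongDual ℝ E) (b : ℝ) :
    ridge σ ℓ b ∈ ridgeSpan E σ :=
  Submodule.subset_span ⟨(ℓ, b), rfl⟩

theorem const_mem_ridgeSpan {σ : C(ℝ, ℝ)} (hσ : σ ≠ 0) (c : ℝ) :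
    ContinuousMap.const E c ∈ ridgeSpan E σ := by
  obtain ⟨z, hz⟩ := DFunLike.ne_iff.1 hσ
  convert (ridgeSpan E σ).smul_mem (c / σ z) (ridge_mem_ridgeSpan σ 0 z)
  ext x
  simp [ridge, div_mul_cancel₀ c hz]

variable {σ : C(ℝ, ℝ)} {l L : ℝ}

theorem comp_mem_closure_ridgeSpan (hbot : Tendsto σ atBot (𝓝 l)) (htop : Tendsto σ atTop (𝓝 L))
    (hlL : l ≠ L) (g : C(ℝ, ℝ)) (ℓ : StrongDual ℝ E) :
    g.comp ℓ ∈ closure (ridgeSpan E σ : Set C(E, ℝ)) := by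
  obtain ⟨C, hC⟩ := exists_forall_abs_le_of_tendsto σ.continuous hbot htop
  have hLl : L - l ≠ 0 := sub_ne_zero.2 hlL.symm
  have hσ : σ ≠ 0 := by
    rintro rfl
    exact hlL (tendsto_nhds_unique hbot tendsto_const_nhds |>.trans
      (tendsto_nhds_unique tendsto_const_nhds htop))
  refine mem_closure_iff_forall_isCompact_abs_sub_lt.2 fun K hK ε hε => ?_
  obtain ⟨R, hR₀, hR⟩ : ∃ R > 0, ∀ x ∈ K, |ℓ x| ≤ R := by
    obtain ⟨R, hR⟩ := hK.exists_bound_of_continuousOn ℓ.continuous.continuousOn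
    exact ⟨max R 1, by positivity, fun x hx => (hR x hx).trans (le_max_left _ _)⟩
  obtain ⟨n, c, b, s, happ⟩ := exists_sigmoid_sum_approx (τ := fun z => (σ z - l) / (L - l))
    (C := (C + |l|) / |L - l|) (g := fun t => g (2 * R * t - R))
    (fun z => by
      rw [abs_div]
      gcongr
      exact (abs_sub _ _).trans (add_le_add_left (hC z) _))
    (by simpa [div_self hLl] using (htop.sub_const l).div_const (L - l))
    (by simpa using (hbot.sub_const l).div_const (L - l)) (by fun_prop) hε
  refine ⟨ContinuousMap.const E (g (-R)) + ∑ k ∈ Finset.range n, (c k / (L - l)) •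
    (ridge σ ((s / (2 * R)) • ℓ) (s / 2 + b k) - ContinuousMap.const E l), ?_, fun x hx => ?_⟩
  · exact add_mem (const_mem_ridgeSpan hσ _) (sum_mem fun k _ => Submodule.smul_mem _ _
      (sub_mem (ridge_mem_ridgeSpan _ _ _) (const_mem_ridgeSpan hσ _)))
  · have hℓx := abs_le.1 (hR x hx)
    have ht : (ℓ x + R) / (2 * R) ∈ Set.Icc (0 : ℝ) 1 :=
      ⟨div_nonneg (by linarith) (by linarith), (div_le_one (by linarith)).2 (by linarith)⟩
    have hrescale : 2 * R * ((ℓ x + R) / (2 * R)) - R = ℓ x := by field_simp; ring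
    have harg : ∀ k, s * (ℓ x / (2 * R)) + (s / 2 + b k) = s * ((ℓ x + R) / (2 * R)) + b k := by
      intro k
      field_simp
      ring
    simpa [ridge, harg, hrescale, div_mul_eq_mul_div, mul_div_assoc] using happ _ ht

/-- Cybenko's theorem: since `exp ∘ ℓ` and `exp ∘ ℓ'` multiply to `exp ∘ (ℓ + ℓ')`, the exponentials
span an algebra, and each of them is approximable in one variable. -/
theorem dense_ridgeSpan [SeparatingDual ℝ E] (hbot : Tendsto σ atBot (𝓝 l))
    (htop : Tendsto σ atTop (𝓝 L)) (hlL : l ≠ L) : Dense (ridgeSpan E σ : Set C(E, ℝ)) := by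
  let expRidge : Multiplicative (StrongDual ℝ E) →* C(E, ℝ) :=
    { toFun := fun ℓ => (⟨Real.exp, Real.continuous_exp⟩ : C(ℝ, ℝ)).comp (ℓ.toAdd : C(E, ℝ))
      map_one' := by ext; simp
      map_mul' := fun ℓ ℓ' => by ext; simp [Real.exp_add] }
  let expAlgebra := Algebra.adjoin ℝ (MonoidHom.mrange expRidge : Set C(E, ℝ))
  have hsep : expAlgebra.SeparatesPoints := by
    intro x y hxy
    obtain ⟨ℓ, hℓ⟩ := SeparatingDual.exists_separating_of_ne (R := ℝ) hxy
    exact ⟨_, ⟨expRidge (Multiplicative.ofAdd ℓ), Algebra.subset_adjoin ⟨_, rfl⟩, rfl⟩,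
      Real.exp_injective.ne hℓ⟩
  have hle : (expAlgebra : Set C(E, ℝ)) ⊆ closure (ridgeSpan E σ) := by
    have : Subalgebra.toSubmodule expAlgebra ≤ (ridgeSpan E σ).topologicalClosure := by
      rw [Algebra.adjoin_eq_span, Submonoid.closure_eq, Submodule.span_le]
      rintro _ ⟨ℓ, rfl⟩
      exact comp_mem_closure_ridgeSpan hbot htop hlL _ _
    exact this
  refine dense_iff_closure_eq.2 (Set.eq_univ_of_univ_subset fun F _ => ?_)
  refine closure_minimal hle isClosed_closure
    (mem_closure_iff_forall_isCompact_abs_sub_lt.2 fun K hK ε hε => ?_)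
  obtain ⟨g, hg, hFg⟩ :=
    ContinuousMap.exists_mem_subalgebra_near_continuous_of_isCompact_of_separatesPoints hsep F hK hε
  exact ⟨g, hg, fun x hx => by simpa [abs_sub_comm] using hFg x hx⟩

theorem exists_limits_ne_of_injective {σ : ℝ → ℝ} (hσ : Continuous σ) (hb : ∃ C, ∀ z, |σ z| ≤ C)
    (hinj : Function.Injective σ) :
    ∃ l L : ℝ, l ≠ L ∧ Tendsto σ atBot (𝓝 l) ∧ Tendsto σ atTop (𝓝 L) := by
  obtain ⟨C, hC⟩ := hb
  have habove : BddAbove (Set.range σ) := ⟨C, Set.forall_mem_range.2 fun z => (abs_le.1 (hC z)).2⟩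
  have hbelow : BddBelow (Set.range σ) :=
    ⟨-C, Set.forall_mem_range.2 fun z => (abs_le.1 (hC z)).1⟩
  rcases hσ.strictMono_of_inj hinj with h | h
  · refine ⟨_, _, ?_, tendsto_atBot_ciInf h.monotone hbelow, tendsto_atTop_ciSup h.monotone habove⟩
    exact ((ciInf_le hbelow 0).trans_lt ((h one_pos).trans_le (le_ciSup habove 1))).ne
  · refine ⟨_, _, ?_, tendsto_atBot_ciSup h.antitone habove, tendsto_atTop_ciInf h.antitone hbelow⟩
    exact ((ciInf_le hbelow 1).trans_lt ((h one_pos).trans_le (le_ciSup habove 0))).ne'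

end UniversalApproximation

section Neuron

variable {Q : Type*} [Fintype Q]

/-- The neuron with weights `v (some q)` and bias `v none`, evaluated at the input `y`. -/
def neuron (σ : ℝ → ℝ) (v : Option Q → ℝ) (y : Q → ℝ) : ℝ :=
  σ (∑ q, v (some q) * y q + v none)

theorem continuous_neuron {σ : ℝ → ℝ} (hσ : Continuous σ) :
    Continuous fun z : (Option Q → ℝ) × (Q → ℝ) => neuron σ z.1 z.2 := by
  unfold neuron
  fun_prop

theorem exists_neuron_eq_ridge (σ : C(ℝ, ℝ)) (ℓ : StrongDual ℝ (Q → ℝ)) (b : ℝ) :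
    ∃ v : Option Q → ℝ, ⇑(ridge σ ℓ b) = neuron σ v := by
  classical
  refine ⟨fun o => o.elim b fun q => ℓ (Pi.single q 1), funext fun y => ?_⟩
  have hℓ : ℓ y = ∑ q, ℓ (Pi.single q 1) * y q :=
    (congrArg ℓ (pi_eq_sum_univ' y)).trans (by simp [mul_comm])
  simp only [ridge, neuron, ContinuousMap.coe_mk, Option.elim_some, Option.elim_none, hℓ]

theorem exists_neuron_sum_approx {X : Type*} [TopologicalSpace X] [CompactSpace X] {σ : ℝ → ℝ}
    (hσ : Continuous σ) (hb : ∃ C, ∀ z, |σ z| ≤ C) (hinj : Function.Injective σ) {φ : X → Q → ℝ}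
    (hφ : Continuous φ) (hφinj : Function.Injective φ) {f : X → ℝ} (hf : Continuous f)
    {ε : ℝ} (hε : 0 < ε) :
    ∃ (n : ℕ) (c : Fin n → ℝ) (v : Fin n → Option Q → ℝ),
      ∀ x, |f x - ∑ j, c j * neuron σ (v j) (φ x)| < ε := by
  obtain ⟨l, L, hlL, hbot, htop⟩ := exists_limits_ne_of_injective hσ hb hinj
  obtain ⟨F, hF⟩ := ContinuousMap.exists_extension' (hφ.isClosedEmbedding hφinj) ⟨f, hf⟩
  obtain ⟨G, hG, hFG⟩ := mem_closure_iff_forall_isCompact_abs_sub_lt.1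
    (dense_ridgeSpan (σ := ⟨σ, hσ⟩) hbot htop hlL F) _ (isCompact_range hφ) ε hε
  obtain ⟨n, c, r, rfl⟩ := Submodule.mem_span_set'.1 hG
  have hr : ∀ j, ∃ v : Option Q → ℝ, ⇑(r j : C(Q → ℝ, ℝ)) = neuron σ v := fun j => by
    obtain ⟨p, hp⟩ := (r j).2
    rw [← hp]
    exact exists_neuron_eq_ridge ⟨σ, hσ⟩ p.1 p.2
  choose v hv using hr
  refine ⟨n, c, v, fun x => ?_⟩
  have hFx : F (φ x) = f x := congrFun hF x
  simpa [hv, hFx] using hFG _ (Set.mem_range_self x)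

end Neuron
section Recursion

theorem eq_of_blockTriangular_mulVec_apply_eq {ι α R : Type*} [Fintype ι] [LinearOrder α] [Ring R]
    [NoZeroDivisors R] {b : ι → α} (hb : Function.Injective b) {U : Matrix ι ι R}
    (hU : U.BlockTriangular b) {v w : ι → R} {p : ι} (hp : U p p ≠ 0)
    (htail : ∀ q, b p < b q → v q = w q) (h : (U *ᵥ v) p = (U *ᵥ w) p) : v p = w p := by
  have hrow : (U *ᵥ (v - w)) p = U p p * (v p - w p) := by
    refine Finset.sum_eq_single p (fun q _ hqp => ?_) (by simp)
    rcases (hb.ne hqp).lt_or_gt with hlt | hgt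
    · exact mul_eq_zero_of_left (hU hlt) _
    · exact mul_eq_zero_of_right _ (sub_eq_zero.2 (htail q hgt))
  rw [mulVec_sub, Pi.sub_apply, h, sub_self] at hrow
  exact sub_eq_zero.1 ((mul_eq_zero.1 hrow.symm).resolve_left hp)

variable {n d : ℕ} {σ : ℝ → ℝ} {U : Matrix (Block n d) (Block n d) ℝ} {a : Fin d → ℝ}

/-- One step of the randomised signature on the last `(n + 1) d` coordinates of the state: the input
`y` enters the first block, and `U` maps the first `n` blocks to the last `n` blocks. -/
def blockStep (σ : ℝ → ℝ) (U : Matrix (Block n d) (Block n d) ℝ) (a : Fin d → ℝ)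
    (r : Block (n + 1) d → ℝ) (y : EuclideanSpace ℝ (Fin d)) : Block (n + 1) d → ℝ :=
  fun p => r p + Fin.cases (σ (a p.2) * y p.2)
    (fun k => σ ((U *ᵥ fun q => r (q.1.castSucc, q.2)) (k, p.2))) p.1

/-- The last `(n + 1) d` coordinates of the randomised signature after the `m` inputs `x`. -/
def blockState (σ : ℝ → ℝ) (U : Matrix (Block n d) (Block n d) ℝ) (a : Fin d → ℝ) :
    (m : ℕ) → (Fin m → EuclideanSpace ℝ (Fin d)) → Block (n + 1) d → ℝ
  | 0, _ => 0
  | m + 1, x => blockStep σ U a (blockState σ U a m (Fin.init x)) (x (Fin.last m))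

theorem blockState_eq_zero (h0 : σ 0 = 0) (hU : U.BlockTriangular toLex) {m : ℕ}
    (x : Fin m → EuclideanSpace ℝ (Fin d)) {p : Block (n + 1) d} (hp : m ≤ p.1) :
    blockState σ U a m x p = 0 := by
  induction m generalizing p with
  | zero => rfl
  | succ m ih =>
    obtain ⟨k, i⟩ := p
    cases k using Fin.cases with
    | zero => simp at hp
    | succ k =>
      have hk : m ≤ k.1 := by simpa using hp
      have hmul :
          (U *ᵥ fun q => blockState σ U a m (Fin.init x) (q.1.castSucc, q.2)) (k, i) = 0 := by
        refine Finset.sum_eq_zero fun q _ => ?_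
        rcases lt_or_ge q.1 k with hlt | hge
        · exact mul_eq_zero_of_left (hU (Prod.Lex.toLex_lt_toLex.2 (Or.inl hlt))) _
        · exact mul_eq_zero_of_right _ (ih _ (hk.trans (Fin.le_def.1 hge)))
      have hprev : blockState σ U a m (Fin.init x) (k.succ, i) = 0 := ih _ (hk.trans k.1.le_succ)
      simp only [blockState, blockStep, Fin.cases_succ, hmul, h0, hprev, add_zero]

theorem blockStep_injective (hinj : Function.Injective σ) (h0 : σ 0 = 0)
    (hU : U.BlockTriangular toLex) (hdiag : ∀ p, U p p ≠ 0) (ha : ∀ i, a i ≠ 0)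
    {r r' : Block (n + 1) d → ℝ} {y y' : EuclideanSpace ℝ (Fin d)}
    (hlast : ∀ i, r (Fin.last n, i) = r' (Fin.last n, i))
    (h : blockStep σ U a r y = blockStep σ U a r' y') : r = r' ∧ y = y' := by
  have hr : ∀ l : Fin (n + 1) ×ₗ Fin d, r (ofLex l) = r' (ofLex l) := by
    intro l
    induction l using WellFoundedGT.induction with
    | ind l ih =>
    obtain ⟨⟨k, i⟩, rfl⟩ := toLex.surjective l
    cases k using Fin.lastCases with
    | last => exact hlast i
    | cast k =>
      have hnext : r (k.succ, i) = r' (k.succ, i) :=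
        ih (toLex (k.succ, i)) (Prod.Lex.toLex_lt_toLex.2 (Or.inl k.castSucc_lt_succ))
      have hstep := congrFun h (k.succ, i)
      simp only [blockStep, Fin.cases_succ, hnext, add_right_inj] at hstep
      refine eq_of_blockTriangular_mulVec_apply_eq (v := fun q => r (q.1.castSucc, q.2))
        (w := fun q => r' (q.1.castSucc, q.2)) toLex.injective hU (hdiag (k, i)) (fun q hq => ?_)
        (hinj hstep)
      exact ih (toLex (q.1.castSucc, q.2)) (by simpa [Prod.Lex.toLex_lt_toLex] using hq)
  obtain rfl : r = r' := funext fun p => hr (toLex p)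
  refine ⟨rfl, PiLp.ext fun i => ?_⟩
  have hai : σ (a i) ≠ 0 := fun hσ => ha i (hinj (hσ.trans h0.symm))
  simpa [blockStep, hai] using congrFun h (0, i)

theorem blockState_injective (hinj : Function.Injective σ) (h0 : σ 0 = 0)
    (hU : U.BlockTriangular toLex) (hdiag : ∀ p, U p p ≠ 0) (ha : ∀ i, a i ≠ 0) {m : ℕ}
    (hm : m ≤ n + 1) : Function.Injective (blockState σ U a m) := by
  induction m with
  | zero => exact fun _ _ _ => Subsingleton.elim _ _
  | succ m ih =>
    intro x y hxy
    obtain ⟨hinit, hlast⟩ := blockStep_injective hinj h0 hU hdiag ha (fun i => by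
      rw [blockState_eq_zero h0 hU _ (Nat.le_of_succ_le_succ hm),
        blockState_eq_zero h0 hU _ (Nat.le_of_succ_le_succ hm)]) hxy
    rw [← Fin.snoc_init_self x, ← Fin.snoc_init_self y, ih (Nat.le_of_succ_le hm) hinit, hlast]

theorem continuous_blockStep (hσ : Continuous σ) :
    Continuous fun z : (Matrix (Block n d) (Block n d) ℝ × (Fin d → ℝ)) ×
      (Block (n + 1) d → ℝ) × EuclideanSpace ℝ (Fin d) => blockStep σ z.1.1 z.1.2 z.2.1 z.2.2 := by
  refine continuous_pi fun ⟨k, i⟩ => ?_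
  cases k using Fin.cases with
  | zero => simp only [blockStep, Fin.cases_zero]; fun_prop
  | succ k => simp only [blockStep, Fin.cases_succ, mulVec, dotProduct]; fun_prop

theorem continuous_blockState (hσ : Continuous σ) (m : ℕ) :
    Continuous fun z : (Matrix (Block n d) (Block n d) ℝ × (Fin d → ℝ)) ×
      (Fin m → EuclideanSpace ℝ (Fin d)) => blockState σ z.1.1 z.1.2 m z.2 := by
  induction m with
  | zero => exact continuous_const
  | succ m ih =>
    have hinit : Continuous (Fin.init : (Fin (m + 1) → EuclideanSpace ℝ (Fin d)) → _) := by
      unfold Fin.init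
      fun_prop
    exact (continuous_blockStep hσ).comp (continuous_fst.prodMk ((ih.comp
      (continuous_fst.prodMk (hinit.comp continuous_snd))).prodMk (by fun_prop)))

end Recursion

section Scheme

theorem RS_succ {ι : Type*} [Fintype ι] {d T : ℕ} (σ : ℝ → ℝ) (A₁ : Matrix ι ι ℝ) (ξ₁ : ι → ℝ)
    (A₂ : Fin d → Matrix ι ι ℝ) (ξ₂ : Fin d → ι → ℝ) (x : Fin T → EuclideanSpace ℝ (Fin d))
    (t : Fin T) (k : ι) :
    RS σ A₁ ξ₁ A₂ ξ₂ x t.succ k = RS σ A₁ ξ₁ A₂ ξ₂ x t.castSucc k +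
      deltaRS σ A₁ ξ₁ A₂ ξ₂ x t k := by
  simp [deltaRS]

theorem deltaRS_apply {ι : Type*} [Fintype ι] {d T : ℕ} (σ : ℝ → ℝ) (A₁ : Matrix ι ι ℝ)
    (ξ₁ : ι → ℝ) (A₂ : Fin d → Matrix ι ι ℝ) (ξ₂ : Fin d → ι → ℝ)
    (x : Fin T → EuclideanSpace ℝ (Fin d)) (t : Fin T) (k : ι) :
    deltaRS σ A₁ ξ₁ A₂ ξ₂ x t k = σ ((A₁ *ᵥ RS σ A₁ ξ₁ A₂ ξ₂ x t.castSucc + ξ₁) k) +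
      ∑ i, x t i * σ ((A₂ i *ᵥ RS σ A₁ ξ₁ A₂ ξ₂ x t.castSucc + ξ₂ i) k) := by
  simp [deltaRS, RS, Finset.sum_apply, add_assoc]

theorem shiftMatrix_mulVec {n d : ℕ} (U : Matrix (Block n d) (Block n d) ℝ)
    (r : Block (n + 1) d → ℝ) (p : Block (n + 1) d) :
    (shiftMatrix (T := n + 1) U *ᵥ r) p =
      Fin.cases 0 (fun k => (U *ᵥ fun q => r (q.1.castSucc, q.2)) (k, p.2)) p.1 := by
  obtain ⟨k, i⟩ := p
  cases k using Fin.cases with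
  | zero => simp [mulVec, dotProduct, shiftMatrix]
  | succ k =>
    simp [mulVec, dotProduct, shiftMatrix, Fintype.sum_prod_type, Fin.sum_univ_castSucc]

variable {M n d T : ℕ} {σ : ℝ → ℝ}

/-- The weights of the `M` random neurons: row `m` of `A` followed by the bias `ξ m`. -/
def rowWeights (A : Matrix (Fin M) (Block T d) ℝ) (ξ : Fin M → ℝ) :
    Fin M → Option (Block T d) → ℝ :=
  fun m o => o.elim (ξ m) (A m)

theorem deltaRS_scheme_inl (h0 : σ 0 = 0) (A : Matrix (Fin M) (Block T d) ℝ)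
    (U : Matrix (Block (T - 1) d) (Block (T - 1) d) ℝ) (ξ : Fin M → ℝ) (a : Fin d → ℝ)
    (x : Fin T → EuclideanSpace ℝ (Fin d)) (t : Fin T) (j : Fin M) :
    deltaRS σ (schemeA₁ A U) (schemeξ₁ T d ξ) (schemeA₂ M T d) (schemeξ₂ M T a) x t (Sum.inl j) =
      neuron σ (rowWeights A ξ j) fun p => RS σ (schemeA₁ A U) (schemeξ₁ T d ξ)
        (schemeA₂ M T d) (schemeξ₂ M T a) x t.castSucc (Sum.inr p) := by
  rw [deltaRS_apply]
  simp [schemeA₁, schemeξ₁, schemeA₂, schemeξ₂, fromBlocks_mulVec, h0, neuron, rowWeights,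
    mulVec, dotProduct]

theorem RS_scheme_succ_inr (h0 : σ 0 = 0) (A : Matrix (Fin M) (Block (n + 1) d) ℝ)
    (U : Matrix (Block n d) (Block n d) ℝ) (ξ : Fin M → ℝ) (a : Fin d → ℝ)
    (x : Fin (n + 1) → EuclideanSpace ℝ (Fin d)) (t : Fin (n + 1)) :
    (fun p => RS σ (schemeA₁ A U) (schemeξ₁ (n + 1) d ξ) (schemeA₂ M (n + 1) d)
      (schemeξ₂ M (n + 1) a) x t.succ (Sum.inr p)) =
      blockStep σ U a (fun p => RS σ (schemeA₁ A U) (schemeξ₁ (n + 1) d ξ) (schemeA₂ M (n + 1) d)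
        (schemeξ₂ M (n + 1) a) x t.castSucc (Sum.inr p)) (x t) := by
  funext ⟨k, i⟩
  rw [RS_succ, deltaRS_apply]
  cases k using Fin.cases <;>
  simp [schemeA₁, schemeξ₁, schemeA₂, schemeξ₂, fromBlocks_mulVec, h0, Function.comp_def,
    shiftMatrix_mulVec, blockStep, apply_ite σ, mul_comm]

theorem RS_scheme_inr_eq_blockState (h0 : σ 0 = 0) (A : Matrix (Fin M) (Block (n + 1) d) ℝ)
    (U : Matrix (Block n d) (Block n d) ℝ) (ξ : Fin M → ℝ) (a : Fin d → ℝ)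
    (x : Fin (n + 1) → EuclideanSpace ℝ (Fin d)) {m : ℕ} (hm : m ≤ n + 1) :
    (fun p => RS σ (schemeA₁ A U) (schemeξ₁ (n + 1) d ξ) (schemeA₂ M (n + 1) d)
      (schemeξ₂ M (n + 1) a) x ⟨m, Nat.lt_succ_of_le hm⟩ (Sum.inr p)) =
      blockState σ U a m fun s => x (s.castLE hm) := by
  induction m with
  | zero => rfl
  | succ m ih =>
    refine (RS_scheme_succ_inr h0 A U ξ a x ⟨m, hm⟩).trans ?_
    rw [blockState, Fin.castSucc_mk, ih (Nat.le_of_succ_le hm)]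
    rfl

theorem deltaRS_last_inl (h0 : σ 0 = 0) (A : Matrix (Fin M) (Block (n + 1) d) ℝ)
    (U : Matrix (Block n d) (Block n d) ℝ) (ξ : Fin M → ℝ) (a : Fin d → ℝ)
    (x : Fin (n + 1) → EuclideanSpace ℝ (Fin d)) (j : Fin M) :
    deltaRS σ (schemeA₁ A U) (schemeξ₁ (n + 1) d ξ) (schemeA₂ M (n + 1) d)
      (schemeξ₂ M (n + 1) a) x (Fin.last n) (Sum.inl j) =
      neuron σ (rowWeights A ξ j) (blockState σ U a n fun s => x s.castSucc) := by
  rw [deltaRS_scheme_inl h0]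
  congr 1
  exact RS_scheme_inr_eq_blockState h0 A U ξ a x n.le_succ

end Scheme

section Readout

variable {X Q Θ ι κ : Type*} [Fintype Q] [Fintype ι] [Fintype κ] {σ : ℝ → ℝ}

/-- The outputs of the neurons `v m` at the features `Φ x` have a linear combination that stays
within `ε` of `f`. -/
def HasReadout (σ : ℝ → ℝ) (Φ : X → Q → ℝ) (f : X → ℝ) (ε : ℝ) (v : κ → Option Q → ℝ) : Prop :=
  ∃ w : κ → ℝ, ∀ x, |f x - ∑ m, w m * neuron σ (v m) (Φ x)| < ε

/-- The family `v` has a member in each of the sets of `𝒱`. -/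
def Visits {E : Type*} (𝒱 : Finset (Set E)) (v : κ → E) : Prop :=
  ∀ V ∈ 𝒱, ∃ m, v m ∈ V

theorem HasReadout.of_comp {Φ : X → Q → ℝ} {f : X → ℝ} {ε : ℝ} {v : κ → Option Q → ℝ} {j : ι → κ}
    (h : HasReadout σ Φ f ε (v ∘ j)) : HasReadout σ Φ f ε v := by
  obtain ⟨c, hc⟩ := h
  have hspan : (∑ i, c i • fun x => neuron σ (v (j i)) (Φ x)) ∈
      Submodule.span ℝ (Set.range fun m x => neuron σ (v m) (Φ x)) :=
    sum_mem fun i _ => Submodule.smul_mem _ _ (Submodule.subset_span ⟨j i, rfl⟩)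
  obtain ⟨w, hw⟩ := (Submodule.mem_span_range_iff_exists_fun ℝ).1 hspan
  refine ⟨w, fun x => ?_⟩
  have hwx : ∑ m, w m * neuron σ (v m) (Φ x) = ∑ i, c i * neuron σ (v (j i)) (Φ x) := by
    simpa using congrFun hw x
  rw [hwx]
  exact hc x

variable [TopologicalSpace X] [CompactSpace X] [TopologicalSpace Θ]

theorem eventually_forall_abs_sub_neuron_sum_lt (hσ : Continuous σ) {Φ : Θ → X → Q → ℝ}
    (hΦ : Continuous (Function.uncurry Φ)) {f : X → ℝ} (hf : Continuous f) {ε : ℝ} {θ₀ : Θ}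
    {c : ι → ℝ} {v₀ : ι → Option Q → ℝ}
    (h : ∀ x, |f x - ∑ j, c j * neuron σ (v₀ j) (Φ θ₀ x)| < ε) :
    ∀ᶠ z : Θ × (ι → Option Q → ℝ) in 𝓝 (θ₀, v₀),
      ∀ x, |f x - ∑ j, c j * neuron σ (z.2 j) (Φ z.1 x)| < ε := by
  have hneuron : ∀ j, Continuous fun z : (Θ × (ι → Option Q → ℝ)) × X =>
      neuron σ (z.1.2 j) (Φ z.1.1 z.2) := fun j =>
    (continuous_neuron hσ).comp (Continuous.prodMk (by fun_prop)
      (hΦ.comp ((continuous_fst.comp continuous_fst).prodMk continuous_snd)))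
  have hcont : Continuous fun z : (Θ × (ι → Option Q → ℝ)) × X =>
      |f z.2 - ∑ j, c j * neuron σ (z.1.2 j) (Φ z.1.1 z.2)| :=
    ((hf.comp continuous_snd).sub
      (continuous_finsetSum _ fun j _ => continuous_const.mul (hneuron j))).abs
  have hev : ∀ᶠ z : Θ × (ι → Option Q → ℝ) in 𝓝 (θ₀, v₀), ∀ x ∈ (Set.univ : Set X),
      |f x - ∑ j, c j * neuron σ (z.2 j) (Φ z.1 x)| < ε :=
    isCompact_univ.eventually_forall_of_forall_eventually fun x _ =>
      hcont.continuousAt.eventually_lt_const (h x)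
  simpa only [Set.mem_univ, true_imp_iff] using hev

theorem exists_mem_nhds_forall_hasReadout (hσ : Continuous σ) (hb : ∃ C, ∀ z, |σ z| ≤ C)
    (hinj : Function.Injective σ) {Φ : Θ → X → Q → ℝ} (hΦ : Continuous (Function.uncurry Φ))
    {f : X → ℝ} (hf : Continuous f) {ε : ℝ} (hε : 0 < ε) {θ₀ : Θ}
    (hθ₀ : Function.Injective (Φ θ₀)) :
    ∃ O ∈ 𝓝 θ₀, ∃ 𝒱 : Finset (Set (Option Q → ℝ)), (∀ V ∈ 𝒱, IsOpen V ∧ V.Nonempty) ∧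
      ∀ θ ∈ O, ∀ (M : ℕ) (v : Fin M → Option Q → ℝ), Visits 𝒱 v → HasReadout σ (Φ θ) f ε v := by
  classical
  obtain ⟨n, c, v₀, h₀⟩ :=
    exists_neuron_sum_approx hσ hb hinj (hΦ.comp (Continuous.prodMk_right θ₀)) hθ₀ hf hε
  obtain ⟨O, hO, W, hW, hOW⟩ := mem_nhds_prod_iff.1
    (eventually_forall_abs_sub_neuron_sum_lt hσ hΦ hf h₀)
  rw [nhds_pi, Filter.mem_pi'] at hW
  obtain ⟨I, t, ht, htW⟩ := hW
  choose V hVt hV hvV using fun j => mem_nhds_iff.1 (ht j)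
  refine ⟨O, hO, Finset.univ.image V, ?_, fun θ hθ M v hv => ?_⟩
  · simpa using fun j => ⟨hV j, ⟨v₀ j, hvV j⟩⟩
  · choose m hm using fun j => hv (V j) (Finset.mem_image_of_mem V (Finset.mem_univ j))
    have hvW : v ∘ m ∈ W := htW fun j _ => hVt j (hm j)
    have hsum := hOW (Set.mk_mem_prod hθ hvW)
    rw [Set.mem_ofPred_eq] at hsum
    exact HasReadout.of_comp ⟨c, hsum⟩

theorem exists_finset_forall_hasReadout (hσ : Continuous σ) (hb : ∃ C, ∀ z, |σ z| ≤ C)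
    (hinj : Function.Injective σ) {Φ : Θ → X → Q → ℝ} (hΦ : Continuous (Function.uncurry Φ))
    {f : X → ℝ} (hf : Continuous f) {ε : ℝ} (hε : 0 < ε) {C : Set Θ} (hC : IsCompact C)
    (hΦinj : ∀ θ ∈ C, Function.Injective (Φ θ)) :
    ∃ 𝒱 : Finset (Set (Option Q → ℝ)), (∀ V ∈ 𝒱, IsOpen V ∧ V.Nonempty) ∧
      ∀ θ ∈ C, ∀ (M : ℕ) (v : Fin M → Option Q → ℝ), Visits 𝒱 v → HasReadout σ (Φ θ) f ε v := by
  classical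
  choose! O hO 𝒱 h𝒱 hread using fun θ (hθ : θ ∈ C) =>
    exists_mem_nhds_forall_hasReadout hσ hb hinj hΦ hf hε (hΦinj θ hθ)
  obtain ⟨t, htC, hCt⟩ := hC.elim_nhds_subcover O hO
  refine ⟨t.biUnion 𝒱, fun V hV => ?_, fun θ hθ M v hv => ?_⟩
  · obtain ⟨θ, hθ, hVθ⟩ := Finset.mem_biUnion.1 hV
    exact h𝒱 θ (htC θ hθ) V hVθ
  · obtain ⟨θ₀, hθ₀, hθO⟩ := Set.mem_iUnion₂.1 (hCt hθ)
    exact hread θ₀ (htC θ₀ hθ₀) θ hθO M v fun V hV => hv V (Finset.mem_biUnion.2 ⟨θ₀, hθ₀, hV⟩)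

end Readout

section Probability

variable {Ω E κ Q : Type*} [MeasurableSpace Ω] [MeasurableSpace E]

theorem exists_isCompact_forall_ne_zero_lt_measure_pi (κ : Type*) [Fintype κ] {μ : Measure ℝ}
    [IsProbabilityMeasure μ] (hμ : μ {0} = 0) {p : ENNReal} (hp : p < 1) :
    ∃ C : Set (κ → ℝ), IsCompact C ∧ (∀ θ ∈ C, ∀ k, θ k ≠ 0) ∧
      p < Measure.pi (fun _ => μ) C := by
  have hμ' : μ {0}ᶜ = 1 := (prob_compl_eq_one_iff (measurableSet_singleton 0)).2 hμ
  have hpi : p < Measure.pi (fun _ : κ => μ) (Set.univ.pi fun _ => {0}ᶜ) := by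
    simpa only [Measure.pi_pi, hμ', Finset.prod_const_one] using hp
  obtain ⟨C, hC₀, hC, hpC⟩ := MeasurableSet.exists_lt_isCompact_of_ne_top
    (.univ_pi fun _ => (measurableSet_singleton 0).compl) (measure_ne_top _ _) hpi
  exact ⟨C, hC, fun θ hθ k => hC₀ hθ k (Set.mem_univ k), hpC⟩

theorem exists_sum_one_sub_pow_lt (ν : Measure E) {𝒱 : Finset (Set E)}
    (h𝒱 : ∀ V ∈ 𝒱, ν V ≠ 0) {p q : ENNReal} (hpq : p < q) :
    ∃ M : ℕ, 1 ≤ M ∧ p + ∑ V ∈ 𝒱, (1 - ν V) ^ M < q := by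
  have hlim : Tendsto (fun M : ℕ => p + ∑ V ∈ 𝒱, (1 - ν V) ^ M) atTop (𝓝 (p + ∑ V ∈ 𝒱, 0)) :=
    tendsto_const_nhds.add (tendsto_finsetSum _ fun V hV =>
      ENNReal.tendsto_pow_atTop_nhds_zero_of_lt_one
        (ENNReal.sub_lt_self ENNReal.one_ne_top one_ne_zero (h𝒱 V hV)))
  rw [Finset.sum_const_zero, add_zero] at hlim
  exact ((eventually_ge_atTop 1).and (hlim.eventually_lt_const hpq)).exists

theorem measurableSet_visits [Countable κ] {𝒱 : Finset (Set E)} (h𝒱 : ∀ V ∈ 𝒱, MeasurableSet V)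
    {v : Ω → κ → E} (hv : Measurable v) : MeasurableSet {ω | Visits 𝒱 (v ω)} := by
  have hvisits : {ω | Visits 𝒱 (v ω)} = ⋂ V ∈ 𝒱, ⋃ m, (fun ω => v ω m) ⁻¹' V := by
    ext ω
    simp [Visits]
  rw [hvisits]
  exact 𝒱.measurableSet_biInter fun V hV =>
    .iUnion fun m => measurable_pi_iff.1 hv m (h𝒱 V hV)

variable [Fintype κ] [Fintype Q] {P : Measure Ω} {μ : Measure ℝ} [IsProbabilityMeasure μ]
  {Z : κ × Q → Ω → ℝ}

theorem measure_forall_row_notMem (hm : ∀ k, Measurable (Z k)) (hlaw : ∀ k, P.map (Z k) = μ)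
    (hind : iIndepFun Z P) {V : Set (Q → ℝ)} (hV : MeasurableSet V) :
    P {ω | ∀ m, (fun q => Z (m, q) ω) ∉ V} =
      (1 - Measure.pi (fun _ => μ) V) ^ Fintype.card κ := by
  have hrows : P.map (fun ω m q => Z (m, q) ω) =
      Measure.pi fun _ : κ => Measure.pi fun _ : Q => μ := by
    have hcurry := Measure.infinitePi_map_curry (fun (_ : κ) (_ : Q) => μ)
    have hZ : P.map (fun ω k => Z k ω) = Measure.infinitePi fun _ => μ := by
      simpa only [hlaw] using hind.map_fun_eq_infinitePi_map hm
    rw [← hZ, Measure.map_map (by fun_prop) (measurable_pi_iff.2 hm)] at hcurry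
    simp only [Measure.infinitePi_eq_pi] at hcurry
    exact hcurry
  have hmiss : {ω | ∀ m, (fun q => Z (m, q) ω) ∉ V} =
      (fun ω m q => Z (m, q) ω) ⁻¹' (Set.univ.pi fun _ => Vᶜ) := by
    ext ω
    simp [Set.mem_pi]
  rw [hmiss, ← Measure.map_apply (by fun_prop) (.univ_pi fun _ => hV.compl), hrows,
    Measure.pi_pi]
  simp only [prob_compl_eq_one_sub hV, Finset.prod_const, Finset.card_univ]

theorem measure_le_measure_inter_visits_add (hm : ∀ k, Measurable (Z k))
    (hlaw : ∀ k, P.map (Z k) = μ) (hind : iIndepFun Z P) {𝒱 : Finset (Set (Q → ℝ))}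
    (h𝒱 : ∀ V ∈ 𝒱, MeasurableSet V) (B : Set Ω) :
    P B ≤ P (B ∩ {ω | Visits 𝒱 fun m q => Z (m, q) ω}) +
      ∑ V ∈ 𝒱, (1 - Measure.pi (fun _ => μ) V) ^ Fintype.card κ := by
  have hcover : B ⊆ (B ∩ {ω | Visits 𝒱 fun m q => Z (m, q) ω}) ∪
      ⋃ V ∈ 𝒱, {ω | ∀ m, (fun q => Z (m, q) ω) ∉ V} := by
    intro ω hω
    by_cases hvisits : Visits 𝒱 fun m q => Z (m, q) ω
    · exact Or.inl ⟨hω, hvisits⟩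
    · exact Or.inr (by simpa [Visits] using hvisits)
  refine (measure_mono hcover).trans ((measure_union_le _ _).trans ?_)
  gcongr
  refine (measure_biUnion_finset_le _ _).trans (Finset.sum_le_sum fun V hV => ?_)
  exact (measure_forall_row_notMem hm hlaw hind (h𝒱 V hV)).le

end Probability

section Parameters

variable {n d : ℕ}

/-- The labels of the free entries of an upper triangular matrix `U` and of the vector `a`. -/
abbrev ParamIndex (n d : ℕ) : Type :=
  {pq : Block n d × Block n d // toLex pq.1 ≤ toLex pq.2} ⊕ Fin d

/-- The upper triangular matrix whose entries on and above the diagonal are given by `θ`. -/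
def paramU (θ : ParamIndex n d → ℝ) : Matrix (Block n d) (Block n d) ℝ :=
  Matrix.of fun p q => if h : toLex p ≤ toLex q then θ (Sum.inl ⟨(p, q), h⟩) else 0

theorem paramU_blockTriangular (θ : ParamIndex n d → ℝ) : (paramU θ).BlockTriangular toLex :=
  fun p q h => by simp [paramU, not_le.2 h]

theorem paramU_self (θ : ParamIndex n d → ℝ) (p : Block n d) :
    paramU θ p p = θ (Sum.inl ⟨(p, p), le_rfl⟩) := by
  simp [paramU]

theorem continuous_paramU : Continuous (paramU : (ParamIndex n d → ℝ) → _) := by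
  refine continuous_matrix fun p q => ?_
  simp only [paramU, Matrix.of_apply]
  split_ifs <;> fun_prop

/-- The free entries of `U` and `a`, as a single vector. -/
def params (U : Matrix (Block n d) (Block n d) ℝ) (a : Fin d → ℝ) : ParamIndex n d → ℝ :=
  Sum.elim (fun pq => U pq.1.1 pq.1.2) a

theorem paramU_params {U : Matrix (Block n d) (Block n d) ℝ} (hU : U.BlockTriangular toLex)
    (a : Fin d → ℝ) : paramU (params U a) = U := by
  ext p q
  simp only [paramU, params, Matrix.of_apply, Sum.elim_inl]
  split_ifs with hpq
  · rfl
  · exact (hU (not_le.1 hpq)).symm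

/-- The state after the inputs `x`, as a function of the free entries `θ` of `U` and `a`. -/
def feature (σ : ℝ → ℝ) (θ : ParamIndex n d → ℝ) (x : Fin n → EuclideanSpace ℝ (Fin d)) :
    Block (n + 1) d → ℝ :=
  blockState σ (paramU θ) (fun i => θ (Sum.inr i)) n x

theorem continuous_feature {σ : ℝ → ℝ} (hσ : Continuous σ) :
    Continuous (Function.uncurry (feature (n := n) (d := d) σ)) :=
  (continuous_blockState hσ n).comp
    (((continuous_paramU.comp continuous_fst).prodMk (by fun_prop)).prodMk continuous_snd)

theorem feature_injective {σ : ℝ → ℝ} (hinj : Function.Injective σ) (h0 : σ 0 = 0)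
    {θ : ParamIndex n d → ℝ} (hθ : ∀ k, θ k ≠ 0) : Function.Injective (feature σ θ) :=
  blockState_injective hinj h0 (paramU_blockTriangular θ)
    (fun p => by simpa only [paramU_self] using hθ _) (fun _ => hθ _) n.le_succ

end Parameters

section SamplingScheme

variable {M T d : ℕ}

/-- The label, among all the random entries, of a weight of a random neuron. -/
def rowIndex (M T d : ℕ) (k : Fin M × Option (Block T d)) : EntryIndex M T d :=
  k.2.elim (Sum.inr (Sum.inr (Sum.inl k.1))) fun p => Sum.inl (k.1, p)

/-- The label, among all the random entries, of an entry of `U` or of `a`. -/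
def paramIndex (M T d : ℕ) : ParamIndex (T - 1) d → EntryIndex M T d :=
  Sum.elim (fun pq => Sum.inr (Sum.inl pq)) fun i => Sum.inr (Sum.inr (Sum.inr i))

theorem rowIndex_injective (M T d : ℕ) : Function.Injective (rowIndex M T d) := by
  rintro ⟨i, _ | p⟩ ⟨j, _ | q⟩ h <;> simp_all [rowIndex]

theorem paramIndex_injective (M T d : ℕ) : Function.Injective (paramIndex M T d) := by
  rintro (p | i) (q | j) h <;> simp_all [paramIndex]

variable {Ω : Type*} {A : Ω → Matrix (Fin M) (Block T d) ℝ}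
  {U : Ω → Matrix (Block (T - 1) d) (Block (T - 1) d) ℝ} {ξ : Ω → Fin M → ℝ} {a : Ω → Fin d → ℝ}

theorem entries_rowIndex (m : Fin M) (o : Option (Block T d)) :
    entries A U ξ a (rowIndex M T d (m, o)) = fun ω => rowWeights (A ω) (ξ ω) m o := by
  cases o <;> rfl

theorem entries_paramIndex (k : ParamIndex (T - 1) d) :
    entries A U ξ a (paramIndex M T d k) = fun ω => params (U ω) (a ω) k := by
  cases k <;> rfl

namespace IsSamplingScheme

variable [MeasurableSpace Ω] {P : Measure Ω} {μ₁ : Measure ℝ} (h : IsSamplingScheme P μ₁ A U ξ a)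
include h

theorem measurable_rowWeights : Measurable fun ω => rowWeights (A ω) (ξ ω) :=
  measurable_pi_iff.2 fun m => measurable_pi_iff.2 fun o => by
    simpa only [entries_rowIndex] using h.measurable (rowIndex M T d (m, o))

theorem measurable_params : Measurable fun ω => params (U ω) (a ω) :=
  measurable_pi_iff.2 fun k => by
    simpa only [entries_paramIndex] using h.measurable (paramIndex M T d k)

theorem map_params : P.map (fun ω => params (U ω) (a ω)) = Measure.pi fun _ => μ₁ := by
  have := h.indep.isProbabilityMeasure
  have hpi := (iIndepFun_iff_map_fun_eq_pi_map fun k => (h.measurable _).aemeasurable).1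
    (h.indep.precomp (paramIndex_injective M T d))
  simp only [h.law] at hpi
  simpa only [entries_paramIndex] using hpi

theorem measure_pi_le_add [IsProbabilityMeasure μ₁] {C : Set (ParamIndex (T - 1) d → ℝ)}
    (hC : MeasurableSet C) {𝒱 : Finset (Set (Option (Block T d) → ℝ))}
    (h𝒱 : ∀ V ∈ 𝒱, MeasurableSet V) :
    Measure.pi (fun _ => μ₁) C ≤
      P {ω | params (U ω) (a ω) ∈ C ∧ Visits 𝒱 (rowWeights (A ω) (ξ ω))} +
        ∑ V ∈ 𝒱, (1 - Measure.pi (fun _ => μ₁) V) ^ M := by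
  have hmiss := measure_le_measure_inter_visits_add (fun _ => h.measurable _) (fun _ => h.law _)
    (h.indep.precomp (rowIndex_injective M T d)) h𝒱 ((fun ω => params (U ω) (a ω)) ⁻¹' C)
  rw [← Measure.map_apply h.measurable_params hC, h.map_params, Fintype.card_fin] at hmiss
  simp only [entries_rowIndex] at hmiss
  exact hmiss

end IsSamplingScheme

theorem exists_width_forall_hasReadout {n d : ℕ} {σ : ℝ → ℝ} (hσ : Continuous σ)
    (hb : ∃ C, ∀ z, |σ z| ≤ C) (hinj : Function.Injective σ) (h0 : σ 0 = 0) {μ₁ : Measure ℝ}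
    [IsProbabilityMeasure μ₁] (hμ : μ₁ {0} = 0) [μ₁.IsOpenPosMeasure]
    {X : Set (Fin n → EuclideanSpace ℝ (Fin d))} (hX : IsCompact X)
    {f : (Fin n → EuclideanSpace ℝ (Fin d)) → ℝ} (hf : ContinuousOn f X) {ε : ℝ} (hε : 0 < ε)
    {p : ENNReal} (hp : p < 1) :
    ∃ M : ℕ, 1 ≤ M ∧
      ∀ (Ω : Type*) [MeasurableSpace Ω] (P : Measure Ω)
        (A : Ω → Matrix (Fin M) (Block (n + 1) d) ℝ) (U : Ω → Matrix (Block n d) (Block n d) ℝ)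
        (ξ : Ω → Fin M → ℝ) (a : Ω → Fin d → ℝ),
        IsSamplingScheme P μ₁ A U ξ a →
        ∃ E : Set Ω, MeasurableSet E ∧ p < P E ∧ ∀ ω ∈ E,
          HasReadout σ (fun x : X => blockState σ (U ω) (a ω) n x) (X.domRestrict f) ε
            (rowWeights (A ω) (ξ ω)) := by
  have : CompactSpace X := isCompact_iff_compactSpace.1 hX
  obtain ⟨C, hC, hC₀, hpC⟩ :=
    exists_isCompact_forall_ne_zero_lt_measure_pi (ParamIndex n d) hμ hp
  obtain ⟨𝒱, h𝒱, hread⟩ := exists_finset_forall_hasReadout hσ hb hinj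
    (Φ := fun θ (x : X) => feature σ θ x.1)
    ((continuous_feature hσ).comp (continuous_id.prodMap continuous_subtype_val))
    (continuousOn_iff_continuous_domRestrict.1 hf) hε hC
    fun θ hθ => (feature_injective hinj h0 (hC₀ θ hθ)).comp Subtype.val_injective
  have h𝒱m : ∀ V ∈ 𝒱, MeasurableSet V := fun V hV => (h𝒱 V hV).1.measurableSet
  obtain ⟨M, hM, hlt⟩ := exists_sum_one_sub_pow_lt (Measure.pi fun _ => μ₁)
    (fun V hV => ((h𝒱 V hV).1.measure_pos _ (h𝒱 V hV).2).ne') hpC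
  refine ⟨M, hM, fun Ω _ P A U ξ a h =>
    ⟨{ω | params (U ω) (a ω) ∈ C ∧ Visits 𝒱 (rowWeights (A ω) (ξ ω))},
      (h.measurable_params hC.measurableSet).inter
        (measurableSet_visits h𝒱m h.measurable_rowWeights),
      lt_of_add_lt_add_right (hlt.trans_le (h.measure_pi_le_add hC.measurableSet h𝒱m)),
      fun ω hω => ?_⟩⟩
  have hω' := hread (params (U ω) (a ω)) hω.1 M _ hω.2
  simp only [feature, paramU_params fun p q => h.upper ω p q] at hω'
  exact hω'

theorem HasReadout.exists_iSup_abs_sub_dotProduct_deltaRS_lt {M n d : ℕ} {σ : ℝ → ℝ}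
    (h0 : σ 0 = 0) {ε : ℝ} (hε : 0 < ε) {K : Set (EuclideanSpace ℝ (Fin d))}
    {f : (Fin n → EuclideanSpace ℝ (Fin d)) → ℝ} {A : Matrix (Fin M) (Block (n + 1) d) ℝ}
    {U : Matrix (Block n d) (Block n d) ℝ} {ξ : Fin M → ℝ} {a : Fin d → ℝ}
    (h : HasReadout σ (fun x : Set.univ.pi fun _ : Fin n => K => blockState σ U a n x)
      (fun x => f x) (ε / 2) (rowWeights A ξ)) :
    ∃ w : Fin M → ℝ,
      (⨆ x : {x : Fin (n + 1) → EuclideanSpace ℝ (Fin d) // ∀ s : Fin n, x s.castSucc ∈ K},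
        ENNReal.ofReal |f (fun s => x.1 s.castSucc) - (Sum.elim w 0 : State M (n + 1) d → ℝ) ⬝ᵥ
          deltaRS σ (schemeA₁ A U) (schemeξ₁ (n + 1) d ξ) (schemeA₂ M (n + 1) d)
            (schemeξ₂ M (n + 1) a) x.1 (Fin.last n)|) < ENNReal.ofReal ε := by
  obtain ⟨w, hw⟩ := h
  refine ⟨w, lt_of_le_of_lt (iSup_le fun x => ENNReal.ofReal_le_ofReal ?_)
    ((ENNReal.ofReal_lt_ofReal_iff hε).2 (half_lt_self hε))⟩
  have hx := hw ⟨fun s => x.1 s.castSucc, fun s _ => x.2 s⟩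
  simpa [dotProduct, deltaRS_last_inl h0] using hx.le

end SamplingScheme

end RandSig

open RandSig in
theorem mainTheorem1_general {d T : ℕ} (hT : 1 ≤ T) (σ : ℝ → ℝ) (hσ : Continuous σ)
    (hb : ∃ C, ∀ z, |σ z| ≤ C) (hinj : Function.Injective σ) (h0 : σ 0 = 0)
    (μ₁ : Measure ℝ) [IsProbabilityMeasure μ₁] (hμ : μ₁ {0} = 0) [μ₁.IsOpenPosMeasure]
    (K : Set (EuclideanSpace ℝ (Fin d))) (hK : IsCompact K)
    (f : (Fin (T - 1) → EuclideanSpace ℝ (Fin d)) → ℝ)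
    (hf : ContinuousOn f (Set.univ.pi fun _ => K)) (α : ℝ) (hα : α < 1) (ε : ℝ) (hε : 0 < ε) :
    ∃ M : ℕ, 1 ≤ M ∧
      ∀ (Ω : Type*) [MeasurableSpace Ω] (P : Measure Ω)
        (A : Ω → Matrix (Fin M) (Block T d) ℝ)
        (U : Ω → Matrix (Block (T - 1) d) (Block (T - 1) d) ℝ)
        (ξ : Ω → Fin M → ℝ) (a : Ω → Fin d → ℝ),
        IsSamplingScheme P μ₁ A U ξ a →
        ∃ E : Set Ω, MeasurableSet E ∧ ENNReal.ofReal α < P E ∧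
          ∀ ω ∈ E, ∃ w : Fin M → ℝ,
            (⨆ x : {x : Fin T → EuclideanSpace ℝ (Fin d) //
                ∀ s : Fin (T - 1), x (Fin.castLE (Nat.sub_le T 1) s) ∈ K},
              ENNReal.ofReal |f (fun s => x.1 (Fin.castLE (Nat.sub_le T 1) s)) -
                (Sum.elim w 0 : State M T d → ℝ) ⬝ᵥ
                  deltaRS σ (schemeA₁ (A ω) (U ω)) (schemeξ₁ T d (ξ ω))
                    (schemeA₂ M T d) (schemeξ₂ M T (a ω)) x.1
                    ⟨T - 1, Nat.sub_lt hT Nat.one_pos⟩|)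
              < ENNReal.ofReal ε := by
  obtain _ | n := T
  · exact absurd hT (by decide)
  obtain ⟨M, hM, hread⟩ := exists_width_forall_hasReadout hσ hb hinj h0 hμ
    (isCompact_univ_pi fun _ => hK) hf (half_pos hε) (ENNReal.ofReal_lt_one.2 hα)
  refine ⟨M, hM, fun Ω _ P A U ξ a h => ?_⟩
  obtain ⟨E, hE, hαE, hω⟩ := hread Ω P A U ξ a h
  exact ⟨E, hE, hαE, fun ω hωE => (hω ω hωE).exists_iSup_abs_sub_dotProduct_deltaRS_lt h0 hε⟩

theorem mainTheorem1 {d T : ℕ} (hd : 1 ≤ d) (hT : 1 ≤ T)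
    (σ : ℝ → ℝ) (hσ : RandSig.IsActivation σ)
    (μ₁ : Measure ℝ) [IsProbabilityMeasure μ₁] (hac : μ₁ ≪ volume) [μ₁.IsOpenPosMeasure]
    (K : Set (EuclideanSpace ℝ (Fin d))) (hK : IsCompact K)
    (f : (Fin (T - 1) → EuclideanSpace ℝ (Fin d)) → ℝ)
    (hf : ContinuousOn f (Set.univ.pi fun _ => K))
    (α : ℝ) (hα : α ∈ Set.Ioo (0 : ℝ) 1) (ε : ℝ) (hε : 0 < ε) :
    ∃ M : ℕ, 1 ≤ M ∧
      ∀ (Ω : Type*) [MeasurableSpace Ω] (P : Measure Ω) [IsProbabilityMeasure P]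
        (A : Ω → Matrix (Fin M) (RandSig.Block T d) ℝ)
        (U : Ω → Matrix (RandSig.Block (T - 1) d) (RandSig.Block (T - 1) d) ℝ)
        (ξ : Ω → Fin M → ℝ) (a : Ω → Fin d → ℝ),
        RandSig.IsSamplingScheme P μ₁ A U ξ a →
        -- an event of probability greater than `α` on which a readout exists
        ∃ E : Set Ω, MeasurableSet E ∧ ENNReal.ofReal α < P E ∧
          ∀ ω ∈ E, ∃ w : Fin M → ℝ,
            -- the supremum is over `x_1, …, x_{T-1} ∈ K` and arbitrary `x_T`
            (⨆ x : {x : Fin T → EuclideanSpace ℝ (Fin d) //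
                ∀ s : Fin (T - 1), x (Fin.castLE (Nat.sub_le T 1) s) ∈ K},
              ENNReal.ofReal |f (fun s => x.1 (Fin.castLE (Nat.sub_le T 1) s)) -
                (Sum.elim w 0 : RandSig.State M T d → ℝ) ⬝ᵥ
                  RandSig.deltaRS σ (RandSig.schemeA₁ (A ω) (U ω)) (RandSig.schemeξ₁ T d (ξ ω))
                    (RandSig.schemeA₂ M T d) (RandSig.schemeξ₂ M T (a ω)) x.1
                    ⟨T - 1, Nat.sub_lt hT Nat.one_pos⟩|)
              < ENNReal.ofReal ε := by
  obtain ⟨M, hM, hread⟩ := mainTheorem1_general hT σ hσ.continuous hσ.bounded hσ.injective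
    hσ.map_zero μ₁ (hac (measure_singleton 0)) K hK f hf α hα.2 ε hε
  exact ⟨M, hM, fun Ω _ P _ => hread Ω P⟩
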